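/- Let $d \ge 3$ and let $Q=(1,d,d+1,\dots,d+1)\in\mathbb{Z}^{d+1}$, with $d-1$ entries equal to $d+1$. Put $v_0=(-d,-d-1,\dots,-d-1)\in\mathbb{Z}^d$ and $v_i=e_i$ for $1\le i\le d$, and let $\Delta_Q=\mathrm{conv}(v_0,\dots,v_d)\subset\mathbb{R}^d$. Then: 1. $\Delta_Q$ is a $d$-dimensional simplex (the points $v_0,\dots,v_d$ are affinely independent) of type $(Q,1)$, that is, $\left|\det(v_0,\dots,\widehat{v_i},\dots,v_d)\right|=q_i$ for every $i$, where $Q=(q_0,\dots,q_d)$, and $\gcd(q_0,\dots,q_d)=1$. 2. $\Delta_Q$ is integrally closed: for every integer $m\ge 0$, each point of $m\Delta_Q\cap\mathbb{Z}^d$ is a sum of $m$ points of $\Delta_Q\cap\mathbb{Z}^d$. 3. $\Delta_Q$ is reflexive: $0$ is an interior point of $\Delta_Q$, and the polar dual $\{y\in\mathbb{R}^d : x\cdot y\le 1 \text{ for all } x\in\Delta_Q\}$ is a lattice polytope, i.e. the convex hull of finitely many points of $\mathbb{Z}^d$. 4. Let $\mathbb{C}[\Delta_Q]=\mathbb{C}[x^az^m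 : m\in\mathbb{Z}_{\ge 0},\ a\in m\Delta_Q\cap\mathbb{Z}^d]$ be the semigroup algebra of $\Delta_Q$ and $R=\mathbb{C}[\Delta_Q]/(x^{v_0}z,\dots,x^{v_d}z)$, graded by the exponent of $z$, with graded pieces $[R]_i$. Then $R$ is Artinian, and for every linear form $l\in[R]_1$ the multiplication map $\times l:[R]_1\to[R]_2$ is not injective. Moreover $R$ has no weak Lefschetz element: there is no $l\in[R]_1$ such that for every $i\ge 0$ the map $\times l:[R]_i\to[R]_{i+1}$ is injective or surjective. -/

import Mathlib

open scoped Pointwise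

noncomputable section

namespace LatticeSimplex

/-- The inclusion of the lattice `ℤⁿ` into `ℝⁿ`. -/
def toReal {n : ℕ} (a : Fin n → ℤ) : Fin n → ℝ := fun i => (a i : ℝ)

/-- A lattice polytope in `ℝⁿ`: the convex hull of finitely many lattice points. -/
def IsLatticePolytope {n : ℕ} (P : Set (Fin n → ℝ)) : Prop :=
  ∃ S : Finset (Fin n → ℤ), P = convexHull ℝ (toReal '' (S : Set (Fin n → ℤ)))

/-- The polar dual `{y | x ⬝ y ≤ 1 for all x ∈ P}`. -/
def polarDual {n : ℕ} (P : Set (Fin n → ℝ)) : Set (Fin n → ℝ) :=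
  {y | ∀ x ∈ P, x ⬝ᵥ y ≤ 1}

/-- Reflexive, in the strict sense (the origin itself is the interior lattice point,
no lattice translation is allowed). -/
def IsReflexive {n : ℕ} (P : Set (Fin n → ℝ)) : Prop :=
  IsLatticePolytope P ∧ (0 : Fin n → ℝ) ∈ interior P ∧ IsLatticePolytope (polarDual P)

/-- Integrally closed: every lattice point of `mP` is a sum of `m` lattice points of `P`. -/
def IsIntegrallyClosed {n : ℕ} (P : Set (Fin n → ℝ)) : Prop :=
  IsLatticePolytope P ∧
    ∀ (m : ℕ) (x : Fin n → ℤ), toReal x ∈ (m : ℝ) • P →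
      ∃ y : Fin m → (Fin n → ℤ), (∀ j, toReal (y j) ∈ P) ∧ x = ∑ j, y j

/-- The polytope in `ℝⁿ` spanned by the lattice points `v₀, …, vₙ`. -/
def simplex {n : ℕ} (v : Fin (n + 1) → (Fin n → ℤ)) : Set (Fin n → ℝ) :=
  convexHull ℝ (Set.range fun i => toReal (v i))

/-- The weights `qᵢ = |det (v₀, …, v̂ᵢ, …, vₙ)|` (here the vectors are the rows). -/
def weight {n : ℕ} (v : Fin (n + 1) → (Fin n → ℤ)) (i : Fin (n + 1)) : ℕ :=
  (Matrix.det (Matrix.of fun j : Fin n => v (i.succAbove j))).natAbs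

/-- `v` has type `(Q, lam)`: `lam` is the gcd of the weights and `Q` is the weight vector
divided by `lam`. -/
def HasType {n : ℕ} (v : Fin (n + 1) → (Fin n → ℤ)) (Q : Fin (n + 1) → ℕ) (lam : ℕ) : Prop :=
  lam = Finset.univ.gcd (weight v) ∧ ∀ i, weight v i = lam * Q i

/-- The monoid of pairs `(a, m)` with `a ∈ mP ∩ ℤⁿ`, where `P` is the polytope spanned by `v`;
`(a, m)` is the exponent of the monomial `xᵃ zᵐ`. -/
def coneMonoid {n : ℕ} (v : Fin (n + 1) → (Fin n → ℤ)) : AddSubmonoid ((Fin n → ℤ) × ℕ) where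
  carrier := {p | toReal p.1 ∈ (p.2 : ℝ) • simplex v}
  zero_mem' := by
    have hne : (simplex v).Nonempty :=
      ⟨toReal (v 0), subset_convexHull ℝ _ (Set.mem_range_self 0)⟩
    have h0 : toReal (0 : Fin n → ℤ) = 0 := by
      funext i
      simp [toReal]
    simp [h0, Set.zero_smul_set hne]
  add_mem' := by
    intro p q hp hq
    have hadd : toReal (p.1 + q.1) = toReal p.1 + toReal q.1 := by
      funext i
      simp [toReal]
    have hconv : Convex ℝ (simplex v) := convex_convexHull ℝ _
    simp only [Set.mem_ofPred_eq, Prod.fst_add, Prod.snd_add, Nat.cast_add] at hp hq ⊢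
    rw [hconv.add_smul (Nat.cast_nonneg _) (Nat.cast_nonneg _), hadd]
    exact Set.add_mem_add hp hq

/-- The exponent `(vᵢ, 1)` of the monomial `x^{vᵢ} z`. -/
def vertexExponent {n : ℕ} (v : Fin (n + 1) → (Fin n → ℤ)) (i : Fin (n + 1)) : coneMonoid v :=
  ⟨(v i, 1), by
    have h : toReal (v i) ∈ simplex v := subset_convexHull ℝ _ (Set.mem_range_self i)
    simpa [coneMonoid] using h⟩

/-- The semigroup algebra `ℂ[P]`, with `ℂ`-basis the monomials `xᵃ zᵐ`, `a ∈ mP ∩ ℤⁿ`. -/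
abbrev SemigroupAlgebra {n : ℕ} (v : Fin (n + 1) → (Fin n → ℤ)) : Type :=
  AddMonoidAlgebra ℂ (coneMonoid v)

/-- The monomial `xᵃ zᵐ` for `s = (a, m)`. -/
def monomial {n : ℕ} (v : Fin (n + 1) → (Fin n → ℤ)) (s : coneMonoid v) : SemigroupAlgebra v :=
  AddMonoidAlgebra.single s 1

/-- The ideal `(x^{v₀} z, …, x^{vₙ} z)`. -/
def vertexIdeal {n : ℕ} (v : Fin (n + 1) → (Fin n → ℤ)) : Ideal (SemigroupAlgebra v) :=
  Ideal.span (Set.range fun i => monomial v (vertexExponent v i))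

/-- The quotient `R_P = ℂ[P] / (x^{v₀} z, …, x^{vₙ} z)`. -/
abbrev R {n : ℕ} (v : Fin (n + 1) → (Fin n → ℤ)) : Type :=
  SemigroupAlgebra v ⧸ vertexIdeal v

/-- The graded piece `[R_P]ₖ`, for the grading by the exponent of `z`. -/
def gradedPiece {n : ℕ} (v : Fin (n + 1) → (Fin n → ℤ)) (k : ℕ) : Submodule ℂ (R v) :=
  Submodule.span ℂ
    {f | ∃ s : coneMonoid v, s.1.2 = k ∧ f = Ideal.Quotient.mk (vertexIdeal v) (monomial v s)}

theorem mul_mem_gradedPiece {n : ℕ} (v : Fin (n + 1) → (Fin n → ℤ)) {j k : ℕ} {f g : R v}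
    (hf : f ∈ gradedPiece v j) (hg : g ∈ gradedPiece v k) : f * g ∈ gradedPiece v (k + j) := by
  have h := Submodule.mul_mem_mul hf hg
  rw [gradedPiece, gradedPiece, Submodule.span_mul_span] at h
  refine Submodule.span_mono ?_ h
  rintro _ ⟨_, ⟨s, hs, rfl⟩, _, ⟨t, ht, rfl⟩, rfl⟩
  refine ⟨s + t, by simp [hs, ht, add_comm], ?_⟩
  simp [monomial, ← map_mul, AddMonoidAlgebra.single_mul_single]

/-- Multiplication `× l : [R_P]ᵢ → [R_P]ᵢ₊₁` by a linear form `l ∈ [R_P]₁`. -/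
def mulMap {n : ℕ} (v : Fin (n + 1) → (Fin n → ℤ)) (l : gradedPiece v 1) (i : ℕ) :
    gradedPiece v i →ₗ[ℂ] gradedPiece v (i + 1) :=
  (LinearMap.mulLeft ℂ (l : R v)).restrict fun _ hf => mul_mem_gradedPiece v l.2 hf

/-- Weak Lefschetz element: every `× l : [R_P]ᵢ → [R_P]ᵢ₊₁` is injective or surjective. -/
def IsWeakLefschetz {n : ℕ} (v : Fin (n + 1) → (Fin n → ℤ)) (l : gradedPiece v 1) : Prop :=
  ∀ i : ℕ, Function.Injective (mulMap v l i) ∨ Function.Surjective (mulMap v l i)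

/-- The weight vector `Q = (1, d, d+1, …, d+1)`, with `d + 1` entries. -/
def weightQ (d : ℕ) : Fin (d + 1) → ℕ :=
  fun i => if (i : ℕ) = 0 then 1 else if (i : ℕ) = 1 then d else d + 1

/-- The vertices `(-d, -d-1, …, -d-1), e₁, …, e_d` of `Δ_Q`, in the order of the entries of `Q`. -/
def vertexQ (d : ℕ) : Fin (d + 1) → (Fin d → ℤ) :=
  Fin.cons (fun j : Fin d => if (j : ℕ) = 0 then -(d : ℤ) else -(d : ℤ) - 1)
    (fun i : Fin d => Pi.single i 1)

end LatticeSimplex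

end

namespace LatticeSimplex

/-! Write `q_j` for `tailWeight`, `c_j` for `facetCoeff`, so `c_j * q_j = d(d+1)`, and `t = m - ∑
x_j` for the height of a lattice point `(x, m)`. The barycentric coordinates of `(x, m)` are `t /
(d(d+1))` at `v₀` and `(c_j x_j + t) / c_j` at `e_j`. The cone is where these are nonnegative; the
facet normals are integral with facets at distance one, which gives reflexivity.

Removing vertices reduces every lattice point of the cone to a box point, and the box monomials form
a basis of `R`. A box point is determined by its height `t`, since `x_j = -⌊t / c_j⌋`. As every
`c_j` is `d` or `d+1`, writing `t = d*k + b` with `k ≤ d`, `b < d` makes it explicit, of degree `b +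
[b < k]`. Box points of degree at least two split off `(1,1)` or `(0,1)`, whence integral closedness
(`exists_degree_one_summand`).

Heights add under multiplication, so `b` is additive modulo `d`. The `d` degree-one monomials with
`b = 0` are therefore sent by any linear form into the span of the `d-1` degree-two monomials with
`b = 1`: injectivity fails. Since `dim [R]₁ ≤ dim [R]₂`, surjectivity would force injectivity, so it
fails too. -/

/-! ### Facets of `Δ_Q` and of its dilates -/

/-- The coefficient of `xⱼ` in the primitive inequality of the facet of `Δ_Q` opposite to `eⱼ`. -/
def facetCoeff (d : ℕ) (j : Fin d) : ℤ := if (j : ℕ) = 0 then d + 1 else d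

/-- The weight of the vertex `eⱼ` of `Δ_Q`. -/
def tailWeight (d : ℕ) (j : Fin d) : ℤ := if (j : ℕ) = 0 then d else d + 1

theorem vertexQ_zero (d : ℕ) : vertexQ d 0 = -tailWeight d := by
  funext j
  simp only [vertexQ, Fin.cons_zero, Pi.neg_apply, tailWeight]
  split_ifs <;> ring

theorem vertexQ_succ (d : ℕ) (i : Fin d) : vertexQ d i.succ = Pi.single i 1 := by
  simp [vertexQ]

theorem facetCoeff_mul_tailWeight (d : ℕ) (j : Fin d) :
    facetCoeff d j * tailWeight d j = d * (d + 1) := by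
  simp only [facetCoeff, tailWeight]
  split_ifs <;> ring

theorem facetCoeff_pos {d : ℕ} (j : Fin d) : 0 < facetCoeff d j := by
  have := j.pos
  simp only [facetCoeff]
  split_ifs <;> omega

theorem tailWeight_pos {d : ℕ} (j : Fin d) : 0 < tailWeight d j := by
  have := j.pos
  simp only [tailWeight]
  split_ifs <;> omega

theorem sum_ite_val_eq_zero {d : ℕ} (hd : 0 < d) (a b : ℤ) :
    ∑ j : Fin d, (if (j : ℕ) = 0 then a else b) = a + (d - 1) * b := by
  obtain ⟨n, rfl⟩ : ∃ n, d = n + 1 := ⟨d - 1, by omega⟩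
  rw [Fin.sum_univ_succ]
  simp

theorem sum_tailWeight {d : ℕ} (hd : 0 < d) : ∑ j, tailWeight d j = d * (d + 1) - 1 := by
  simp only [tailWeight]
  rw [sum_ite_val_eq_zero hd]
  ring

theorem mem_convexHull_range_iff {ι E : Type*} [Fintype ι] [AddCommGroup E] [Module ℝ E]
    (p : ι → E) (y : E) :
    y ∈ convexHull ℝ (Set.range p) ↔
      ∃ w : ι → ℝ, (∀ i, 0 ≤ w i) ∧ ∑ i, w i = 1 ∧ ∑ i, w i • p i = y := by
  classical
  have h : Set.range p =
      Fintype.linearCombination ℝ p '' Set.range fun i : ι => (Pi.single i 1 : ι → ℝ) := by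
    rw [← Set.range_comp]
    congr 1
    funext i
    simp
  rw [h, ← LinearMap.image_convexHull, convexHull_rangle_single_eq_stdSimplex]
  simp [stdSimplex, Fintype.linearCombination_apply, and_assoc]

theorem mem_smul_convexHull_range_iff {ι E : Type*} [Fintype ι] [Nonempty ι] [AddCommGroup E]
    [Module ℝ E] (p : ι → E) {c : ℝ} (hc : 0 ≤ c) (y : E) :
    y ∈ c • convexHull ℝ (Set.range p) ↔
      ∃ w : ι → ℝ, (∀ i, 0 ≤ w i) ∧ ∑ i, w i = c ∧ ∑ i, w i • p i = y := by
  rw [Set.mem_smul_set]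
  constructor
  · rintro ⟨x, hx, rfl⟩
    obtain ⟨w, hw, hs, rfl⟩ := (mem_convexHull_range_iff p x).1 hx
    refine ⟨fun i => c * w i, fun i => mul_nonneg hc (hw i), ?_, ?_⟩
    · rw [← Finset.mul_sum, hs, mul_one]
    · simp [Finset.smul_sum, mul_smul]
  · rintro ⟨w, hw, hs, rfl⟩
    -- For `c = 0` all weights vanish, so any point of the hull serves as preimage of `0`.
    rcases hc.eq_or_lt with rfl | hc
    · have hw0 : ∀ i, w i = 0 := fun i =>
        (Finset.sum_eq_zero_iff_of_nonneg fun i _ => hw i).1 hs i (Finset.mem_univ i)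
      exact ⟨p (Classical.arbitrary ι), subset_convexHull ℝ _ (Set.mem_range_self _), by simp [hw0]⟩
    · refine ⟨∑ i, (c⁻¹ * w i) • p i, (mem_convexHull_range_iff p _).2
        ⟨fun i => c⁻¹ * w i, fun i => mul_nonneg (inv_nonneg.2 hc.le) (hw i), ?_, rfl⟩, ?_⟩
      · rw [← Finset.mul_sum, hs, inv_mul_cancel₀ hc.ne']
      · simp [Finset.smul_sum, smul_smul, hc.ne']

theorem sum_smul_vertexQ (d : ℕ) (w : Fin (d + 1) → ℝ) (j : Fin d) :
    (∑ i, w i • toReal (vertexQ d i)) j = w j.succ - tailWeight d j * w 0 := by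
  rw [Fin.sum_univ_succ, Pi.add_apply, Finset.sum_apply]
  simp only [vertexQ_zero, vertexQ_succ, toReal, Pi.smul_apply, smul_eq_mul, Pi.neg_apply,
    Int.cast_neg, Pi.single_apply, Int.cast_ite, Int.cast_one, Int.cast_zero, mul_ite, mul_one,
    mul_zero, Finset.sum_ite_eq, Finset.mem_univ, if_true]
  ring

/-- The facet description of the dilates of `Δ_Q`. -/
theorem mem_smul_simplex_iff {d : ℕ} (hd : 0 < d) {c : ℝ} (hc : 0 ≤ c) (y : Fin d → ℝ) :
    y ∈ c • simplex (vertexQ d) ↔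
      0 ≤ c - ∑ j, y j ∧ ∀ j, 0 ≤ facetCoeff d j * y j + (c - ∑ j, y j) := by
  have hd' : (0 : ℝ) < d := by exact_mod_cast hd
  have hq : ∑ j, (tailWeight d j : ℝ) = d * (d + 1) - 1 := by
    exact_mod_cast congrArg (Int.cast : ℤ → ℝ) (sum_tailWeight hd)
  have hcq : ∀ j, (facetCoeff d j : ℝ) * tailWeight d j = d * (d + 1) := fun j => by
    exact_mod_cast congrArg (Int.cast : ℤ → ℝ) (facetCoeff_mul_tailWeight d j)
  have hcpos : ∀ j, (0 : ℝ) < facetCoeff d j := fun j => by exact_mod_cast facetCoeff_pos j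
  have hN : (0 : ℝ) < d * (d + 1) := by positivity
  rw [simplex, mem_smul_convexHull_range_iff _ hc]
  constructor
  · rintro ⟨w, hw, hs, rfl⟩
    simp only [sum_smul_vertexQ, Finset.sum_sub_distrib, ← Finset.sum_mul, hq]
    rw [Fin.sum_univ_succ] at hs
    have ht : c - (∑ i : Fin d, w i.succ - (d * (d + 1) - 1) * w 0) = d * (d + 1) * w 0 := by
      rw [← hs]; ring
    rw [ht]
    refine ⟨mul_nonneg hN.le (hw 0), fun j => ?_⟩
    have : (facetCoeff d j : ℝ) * (w j.succ - tailWeight d j * w 0) + d * (d + 1) * w 0 =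
        facetCoeff d j * w j.succ := by
      rw [← hcq j]; ring
    rw [this]
    exact mul_nonneg (hcpos j).le (hw _)
  · rintro ⟨h0, h⟩
    set t : ℝ := c - ∑ j, y j with ht
    -- The barycentric coordinates, obtained by solving `y_j = w_j - q_j w_0` together with `∑ w =
    -- c`.
    refine ⟨Fin.cons (t / (d * (d + 1))) fun j => y j + tailWeight d j * (t / (d * (d + 1))),
      ?_, ?_, ?_⟩
    · intro i
      refine Fin.cases ?_ (fun j => ?_) i
      · simpa using div_nonneg h0 hN.le
      · have : y j + tailWeight d j * (t / (d * (d + 1))) =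
            (facetCoeff d j * y j + t) / facetCoeff d j := by
          rw [← hcq j]
          have h1 := (hcpos j).ne'
          have h2 : (tailWeight d j : ℝ) ≠ 0 := by exact_mod_cast (tailWeight_pos j).ne'
          field_simp
        simpa only [Fin.cons_succ, this] using div_nonneg (h j) (hcpos j).le
    · rw [Fin.sum_univ_succ]
      simp only [Fin.cons_zero, Fin.cons_succ, Finset.sum_add_distrib, ← Finset.sum_mul, hq]
      have : (d : ℝ) * (d + 1) * (t / (d * (d + 1))) = t := mul_div_cancel₀ _ hN.ne'
      linear_combination this + ht
    · funext j
      rw [sum_smul_vertexQ]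
      simp

theorem mem_simplex_iff {d : ℕ} (hd : 0 < d) (y : Fin d → ℝ) :
    y ∈ simplex (vertexQ d) ↔
      0 ≤ 1 - ∑ j, y j ∧ ∀ j, 0 ≤ facetCoeff d j * y j + (1 - ∑ j, y j) := by
  rw [← mem_smul_simplex_iff hd zero_le_one, one_smul]

theorem toReal_mem_smul_simplex_iff {d : ℕ} (hd : 0 < d) (x : Fin d → ℤ) (m : ℕ) :
    toReal x ∈ (m : ℝ) • simplex (vertexQ d) ↔
      0 ≤ m - ∑ j, x j ∧ ∀ j, 0 ≤ facetCoeff d j * x j + (m - ∑ j, x j) := by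
  rw [mem_smul_simplex_iff hd (Nat.cast_nonneg m)]
  simp only [toReal]
  norm_cast

/-! ### Affine independence and the type of `Δ_Q` -/

theorem affineIndependent_vertexQ {d : ℕ} (hd : 0 < d) :
    AffineIndependent ℝ (fun i => toReal (vertexQ d i)) := by
  rw [affineIndependent_iff_linearIndependent_vsub ℝ _ (0 : Fin (d + 1)),
    ← linearIndependent_equiv (finSuccAboveEquiv (0 : Fin (d + 1))),
    Fintype.linearIndependent_iff]
  intro g hg
  have key : ∀ j, g j = -(tailWeight d j * ∑ i, g i) := by
    intro j
    have hj := congrFun hg j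
    rw [Finset.sum_apply] at hj
    simp [finSuccAboveEquiv_apply, vertexQ_zero, vertexQ_succ, toReal, Pi.single_apply, mul_add,
      Finset.sum_add_distrib, ← Finset.sum_mul] at hj
    linarith
  have hq : ∑ j, (tailWeight d j : ℝ) = d * (d + 1) - 1 := by
    exact_mod_cast congrArg (Int.cast : ℤ → ℝ) (sum_tailWeight hd)
  -- Summing `key` over `j` gives `(1 + ∑ q_j) * ∑ g = 0`, where `1 + ∑ q_j = d(d+1)`.
  have hsum : ∑ i, g i = 0 := by
    have h := Finset.sum_congr rfl fun j (_ : j ∈ Finset.univ) => key j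
    rw [Finset.sum_neg_distrib, ← Finset.sum_mul, hq] at h
    have hN : (d : ℝ) * (d + 1) ≠ 0 := by positivity
    exact (mul_eq_zero.1 (by linear_combination h : (d : ℝ) * (d + 1) * ∑ i, g i = 0)).resolve_left hN
  intro j
  rw [key j, hsum]
  simp

theorem weight_vertexQ_zero (d : ℕ) : weight (vertexQ d) 0 = 1 := by
  have : (Matrix.of fun j : Fin d => vertexQ d ((0 : Fin (d + 1)).succAbove j)) = 1 := by
    ext i j
    simp [vertexQ_succ, Matrix.one_apply, Pi.single_apply, eq_comm]
  rw [weight, this]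
  simp

theorem weight_vertexQ_succ (d : ℕ) (i : Fin d) :
    (weight (vertexQ d) i.succ : ℤ) = tailWeight d i := by
  obtain ⟨n, rfl⟩ : ∃ n, d = n + 1 := ⟨d - 1, by have := i.pos; omega⟩
  -- Expand along the row `v₀`. The other rows are the `e_a` with `a ≠ i`, so deleting a column
  -- other than `i` leaves a zero row.
  rw [weight, Matrix.det_succ_row_zero, Finset.sum_eq_single i]
  · have h : (Matrix.of fun j : Fin (n + 1) => vertexQ (n + 1) (i.succ.succAbove j)).submatrix
        Fin.succ i.succAbove = 1 := by
      ext a b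
      simp [Fin.succ_succAbove_succ, vertexQ_succ, Matrix.one_apply, Pi.single_apply, eq_comm]
    rw [h]
    simp [vertexQ_zero, Int.natAbs_mul, Int.natAbs_pow, abs_of_pos (tailWeight_pos i)]
  · intro j _ hj
    obtain ⟨a, ha⟩ := Fin.exists_succAbove_eq hj
    rw [Matrix.det_eq_zero_of_row_eq_zero a, mul_zero]
    intro b
    simp [Fin.succ_succAbove_succ, vertexQ_succ, ha, Fin.succAbove_ne]
  · simp

theorem hasType_vertexQ (d : ℕ) : HasType (vertexQ d) (weightQ d) 1 := by
  constructor
  · have h : Finset.univ.gcd (weight (vertexQ d)) ∣ weight (vertexQ d) 0 :=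
      Finset.gcd_dvd (Finset.mem_univ 0)
    rw [weight_vertexQ_zero] at h
    exact (Nat.dvd_one.1 h).symm
  · intro i
    rw [one_mul]
    refine Fin.cases ?_ (fun j => ?_) i
    · simp [weight_vertexQ_zero, weightQ]
    · zify
      rw [weight_vertexQ_succ]
      simp [tailWeight, weightQ]

/-! ### Reflexivity -/

theorem isLatticePolytope_convexHull_range {n : ℕ} {ι : Type*} [Finite ι] (v : ι → Fin n → ℤ) :
    IsLatticePolytope (convexHull ℝ (Set.range fun i => toReal (v i))) := by
  refine ⟨(Set.finite_range v).toFinset, ?_⟩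
  rw [Set.Finite.coe_toFinset, ← Set.range_comp]
  rfl

theorem isLatticePolytope_simplex {n : ℕ} (v : Fin (n + 1) → Fin n → ℤ) :
    IsLatticePolytope (simplex v) :=
  isLatticePolytope_convexHull_range v

theorem zero_mem_interior_simplex {d : ℕ} (hd : 0 < d) :
    (0 : Fin d → ℝ) ∈ interior (simplex (vertexQ d)) := by
  rw [mem_interior]
  refine ⟨{y | 0 < 1 - ∑ j, y j} ∩ ⋂ j, {y | 0 < facetCoeff d j * y j + (1 - ∑ j, y j)},
    ?_, ?_, ?_⟩
  · rintro y ⟨h0, h⟩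
    rw [Set.mem_iInter] at h
    exact (mem_simplex_iff hd y).2 ⟨le_of_lt h0, fun j => le_of_lt (h j)⟩
  · refine (isOpen_lt continuous_const (by fun_prop)).inter
      (isOpen_iInter_of_finite fun j => isOpen_lt continuous_const (by fun_prop))
  · simp

/-- The vertices of the polar dual of `Δ_Q`. -/
def dualVertexQ (d : ℕ) : Fin (d + 1) → Fin d → ℤ :=
  Fin.cons 1 fun i => 1 - Pi.single i (facetCoeff d i)

theorem sum_smul_dualVertexQ (d : ℕ) (w : Fin (d + 1) → ℝ) (j : Fin d) :
    (∑ i, w i • toReal (dualVertexQ d i)) j = ∑ i, w i - facetCoeff d j * w j.succ := by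
  rw [Fin.sum_univ_succ, Pi.add_apply, Finset.sum_apply]
  simp [dualVertexQ, toReal, Pi.single_apply, mul_sub, Fin.sum_univ_succ, Finset.sum_sub_distrib]
  ring

theorem mem_polarDual_convexHull_range_iff {n : ℕ} {ι : Type*} (p : ι → Fin n → ℝ)
    (y : Fin n → ℝ) :
    y ∈ polarDual (convexHull ℝ (Set.range p)) ↔ ∀ i, p i ⬝ᵥ y ≤ 1 := by
  refine ⟨fun h i => h _ (subset_convexHull ℝ _ (Set.mem_range_self i)), fun h => ?_⟩
  have hconv : Convex ℝ {x : Fin n → ℝ | x ⬝ᵥ y ≤ 1} :=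
    convex_halfSpace_le ⟨fun a b => add_dotProduct a b y, fun c a => smul_dotProduct c a y⟩ 1
  exact fun x hx => convexHull_min (by rintro _ ⟨i, rfl⟩; exact h i) hconv hx

theorem mem_polarDual_simplex_iff {d : ℕ} (y : Fin d → ℝ) :
    y ∈ polarDual (simplex (vertexQ d)) ↔
      -1 ≤ ∑ j, tailWeight d j * y j ∧ ∀ j, y j ≤ 1 := by
  rw [simplex, mem_polarDual_convexHull_range_iff, Fin.forall_fin_succ]
  refine and_congr ?_ (forall_congr' fun j => ?_)
  · simp only [vertexQ_zero, toReal, dotProduct, Pi.neg_apply, Int.cast_neg, neg_mul,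
      Finset.sum_neg_distrib]
    exact neg_le
  · simp [vertexQ_succ, toReal, dotProduct, Pi.single_apply]

/-- The dual vertices are the normals of the facets `∑ y ≤ 1` and `∑ y - c_j y_j ≤ 1` of `Δ_Q`,
which are integral. -/
theorem polarDual_simplex {d : ℕ} (hd : 0 < d) :
    polarDual (simplex (vertexQ d)) =
      convexHull ℝ (Set.range fun i => toReal (dualVertexQ d i)) := by
  have hd' : (0 : ℝ) < d := by exact_mod_cast hd
  have hq : ∑ j, (tailWeight d j : ℝ) = d * (d + 1) - 1 := by
    exact_mod_cast congrArg (Int.cast : ℤ → ℝ) (sum_tailWeight hd)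
  have hcq : ∀ j, (tailWeight d j : ℝ) * facetCoeff d j = d * (d + 1) := fun j => by
    rw [mul_comm]
    exact_mod_cast congrArg (Int.cast : ℤ → ℝ) (facetCoeff_mul_tailWeight d j)
  have hcpos : ∀ j, (0 : ℝ) < facetCoeff d j := fun j => by exact_mod_cast facetCoeff_pos j
  have hN : (0 : ℝ) < d * (d + 1) := by positivity
  ext y
  rw [mem_polarDual_simplex_iff, mem_convexHull_range_iff]
  constructor
  · rintro ⟨h0, h⟩
    have hterm : ∀ j, (1 - y j) / facetCoeff d j =
        (tailWeight d j - tailWeight d j * y j) / (d * (d + 1)) := by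
      intro j
      rw [← hcq j]
      have h1 := (hcpos j).ne'
      have h2 : (tailWeight d j : ℝ) ≠ 0 := by exact_mod_cast (tailWeight_pos j).ne'
      field_simp
    have hs : ∑ i, (Fin.cons ((1 + ∑ j, tailWeight d j * y j) / (d * (d + 1)))
        fun j => (1 - y j) / facetCoeff d j : Fin (d + 1) → ℝ) i = 1 := by
      rw [Fin.sum_univ_succ]
      simp only [Fin.cons_zero, Fin.cons_succ, hterm]
      rw [← Finset.sum_div, Finset.sum_sub_distrib, hq, ← add_div, div_eq_one_iff_eq hN.ne']
      ring
    refine ⟨_, ?_, hs, ?_⟩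
    · intro i
      refine Fin.cases ?_ (fun j => ?_) i
      · simpa only [Fin.cons_zero] using div_nonneg (by linarith) hN.le
      · simpa only [Fin.cons_succ] using div_nonneg (by linarith [h j]) (hcpos j).le
    · funext j
      rw [sum_smul_dualVertexQ, hs, Fin.cons_succ, mul_div_cancel₀ _ (hcpos j).ne']
      ring
  · rintro ⟨w, hw, hs, rfl⟩
    simp only [sum_smul_dualVertexQ, hs]
    refine ⟨?_, fun j => by linarith [mul_nonneg (hcpos j).le (hw j.succ)]⟩
    simp only [mul_sub, mul_one, ← mul_assoc, hcq, Finset.sum_sub_distrib, hq, ← Finset.mul_sum]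
    rw [Fin.sum_univ_succ] at hs
    have : ∑ i : Fin d, w i.succ ≤ 1 := by linarith [hw 0]
    nlinarith

theorem isReflexive_simplex_vertexQ {d : ℕ} (hd : 0 < d) :
    IsReflexive (simplex (vertexQ d)) := by
  refine ⟨isLatticePolytope_simplex _, zero_mem_interior_simplex hd, ?_⟩
  rw [polarDual_simplex hd]
  exact isLatticePolytope_convexHull_range _


/-! ### Lattice points of the cone over `Δ_Q` -/

/-- The lattice distance of `(x, m)` from the facet of the cone over `Δ_Q` opposite to `v₀`. -/
def height {d : ℕ} (p : (Fin d → ℤ) × ℕ) : ℤ := p.2 - ∑ j, p.1 j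

theorem height_add {d : ℕ} (p q : (Fin d → ℤ) × ℕ) : height (p + q) = height p + height q := by
  simp [height, Finset.sum_add_distrib]
  ring

theorem mem_coneMonoid_iff {d : ℕ} (hd : 0 < d) (p : (Fin d → ℤ) × ℕ) :
    p ∈ coneMonoid (vertexQ d) ↔
      0 ≤ height p ∧ ∀ j, 0 ≤ facetCoeff d j * p.1 j + height p :=
  toReal_mem_smul_simplex_iff hd p.1 p.2

/-- The barycentric coordinates sum to the degree, cleared of denominators. -/
theorem mul_degree_eq {d : ℕ} (hd : 0 < d) (p : (Fin d → ℤ) × ℕ) :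
    (d * (d + 1) : ℤ) * p.2 =
      height p + ∑ j, tailWeight d j * (facetCoeff d j * p.1 j + height p) := by
  simp only [mul_add, ← mul_assoc, Finset.sum_add_distrib, ← Finset.sum_mul, sum_tailWeight hd,
    mul_comm (tailWeight d _) (facetCoeff d _), facetCoeff_mul_tailWeight]
  rw [← Finset.mul_sum, height]
  ring

theorem height_vertexQ_zero {d : ℕ} (hd : 0 < d) :
    height (vertexQ d 0, 1) = d * (d + 1) := by
  simp [height, vertexQ_zero, sum_tailWeight hd]

theorem height_vertexQ_succ {d : ℕ} (i : Fin d) : height (vertexQ d i.succ, 1) = 0 := by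
  simp [height, vertexQ_succ]

/-- The lattice points `(x, m)` of the cone over `Δ_Q` all of whose barycentric coordinates
are less than `1`. -/
def IsBoxPoint {d : ℕ} (p : (Fin d → ℤ) × ℕ) : Prop :=
  height p < d * (d + 1) ∧ ∀ j, facetCoeff d j * p.1 j + height p < facetCoeff d j

/-- Subtracting a vertex lowers its own barycentric coordinate by one and leaves the others
unchanged, so a coordinate that is at least `1` can be spared. -/
theorem exists_eq_add_vertexQ {d : ℕ} (hd : 0 < d) {p : (Fin d → ℤ) × ℕ}
    (hp : p ∈ coneMonoid (vertexQ d)) (hbox : ¬ IsBoxPoint p) :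
    ∃ i, ∃ q ∈ coneMonoid (vertexQ d), p = q + (vertexQ d i, 1) := by
  have hN : (0 : ℤ) < d * (d + 1) := by positivity
  obtain ⟨h0, h⟩ := (mem_coneMonoid_iff hd p).1 hp
  have hnonneg : ∀ j ∈ Finset.univ,
      0 ≤ tailWeight d j * (facetCoeff d j * p.1 j + height p) :=
    fun j _ => mul_nonneg (tailWeight_pos j).le (h j)
  have hdeg := mul_degree_eq hd p
  -- One coordinate at least `1` forces degree at least `1`, so the truncated `p.2 - 1` below is a
  -- true subtraction.
  have hm : (d * (d + 1) : ℤ) ≤ d * (d + 1) * p.2 := by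
    rw [hdeg]
    rw [IsBoxPoint, not_and_or] at hbox
    rcases hbox with hbox | hbox
    · linarith [Finset.sum_nonneg hnonneg]
    · push Not at hbox
      obtain ⟨j, hj⟩ := hbox
      have h1 := Finset.single_le_sum hnonneg (Finset.mem_univ j)
      have h2 := mul_le_mul_of_nonneg_left hj (tailWeight_pos j).le
      rw [mul_comm (tailWeight d j) (facetCoeff d j), facetCoeff_mul_tailWeight] at h2
      linarith
  have hm1 : 1 ≤ p.2 := by
    by_contra hlt
    have : p.2 = 0 := by omega
    rw [this] at hm
    simp only [Nat.cast_zero, mul_zero] at hm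
    linarith
  have hsub : ∀ i, p = (p.1 - vertexQ d i, p.2 - 1) + (vertexQ d i, 1) := by
    intro i
    ext1
    · simp
    · simp only [Prod.snd_add]
      omega
  have hheight : ∀ i, height (p.1 - vertexQ d i, p.2 - 1) = height p - height (vertexQ d i, 1) := by
    intro i
    conv_rhs => rw [hsub i, height_add]
    ring
  rw [IsBoxPoint, not_and_or] at hbox
  rcases hbox with hbox | hbox
  · refine ⟨0, _, (mem_coneMonoid_iff hd _).2 ?_, hsub 0⟩
    rw [hheight, height_vertexQ_zero hd]
    refine ⟨by linarith, fun j => ?_⟩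
    simp only [vertexQ_zero, sub_neg_eq_add, Pi.add_apply, mul_add, facetCoeff_mul_tailWeight]
    linarith [h j]
  · push Not at hbox
    obtain ⟨i, hi⟩ := hbox
    refine ⟨i.succ, _, (mem_coneMonoid_iff hd _).2 ?_, hsub i.succ⟩
    rw [hheight, height_vertexQ_succ, sub_zero]
    refine ⟨h0, fun j => ?_⟩
    simp only [vertexQ_succ, Pi.sub_apply, Pi.single_apply]
    split_ifs with hji
    · subst hji
      linarith
    · simpa using h j

theorem not_isBoxPoint_add_vertexQ {d : ℕ} (hd : 0 < d) {p : (Fin d → ℤ) × ℕ}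
    (hp : p ∈ coneMonoid (vertexQ d)) (i : Fin (d + 1)) :
    ¬ IsBoxPoint (p + (vertexQ d i, 1)) := by
  obtain ⟨h0, h⟩ := (mem_coneMonoid_iff hd p).1 hp
  rintro ⟨hb0, hb⟩
  rw [height_add] at hb0 hb
  induction i using Fin.cases with
  | zero =>
    rw [height_vertexQ_zero hd] at hb0
    linarith
  | succ i =>
    have hi := hb i
    rw [height_vertexQ_succ] at hi
    simp only [Prod.fst_add, Pi.add_apply, vertexQ_succ, Pi.single_eq_same] at hi
    linarith [h i]

/-! ### Parametrization of the box points -/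

/-- The degree of the box point with parameters `(k, b)`. -/
def boxDegree (k b : ℕ) : ℕ := b + if b < k then 1 else 0

/-- The box point of height `d * k + b`. -/
def boxPoint (d k b : ℕ) : (Fin d → ℤ) × ℕ :=
  (fun j => if (j : ℕ) = 0 then (if b < k then 1 else 0) - (k : ℤ) else -(k : ℤ), boxDegree k b)

theorem height_boxPoint {d : ℕ} (hd : 0 < d) (k b : ℕ) :
    height (boxPoint d k b) = d * k + b := by
  simp only [height, boxPoint, boxDegree]
  rw [sum_ite_val_eq_zero hd]
  push_cast
  ring

/-- The entries are `-⌊(d*k + b) / c_j⌋`: the floor is `k` for `c_j = d`. For `c_j = d + 1`, since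
`d*k + b = (d+1)*k + (b - k)`, it drops to `k - 1` exactly when `b < k`. -/
theorem boxPoint_facet_bounds {d k b : ℕ} (hk : k ≤ d) (hb : b < d) (j : Fin d) :
    0 ≤ facetCoeff d j * (boxPoint d k b).1 j + height (boxPoint d k b) ∧
      facetCoeff d j * (boxPoint d k b).1 j + height (boxPoint d k b) < facetCoeff d j := by
  rw [height_boxPoint (by omega)]
  simp only [boxPoint, facetCoeff]
  split_ifs <;> ring_nf <;> omega

theorem boxPoint_mem {d k b : ℕ} (hk : k ≤ d) (hb : b < d) :
    boxPoint d k b ∈ coneMonoid (vertexQ d) := by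
  have hd : 0 < d := by omega
  refine (mem_coneMonoid_iff hd _).2 ⟨?_, fun j => (boxPoint_facet_bounds hk hb j).1⟩
  rw [height_boxPoint hd]
  positivity

theorem isBoxPoint_boxPoint {d k b : ℕ} (hk : k ≤ d) (hb : b < d) :
    IsBoxPoint (boxPoint d k b) := by
  have hd : 0 < d := by omega
  refine ⟨?_, fun j => (boxPoint_facet_bounds hk hb j).2⟩
  rw [height_boxPoint hd]
  have : (d : ℤ) * k ≤ d * d := by gcongr
  have : (b : ℤ) < d := by exact_mod_cast hb
  linarith

theorem int_eq_of_mul_add_bounds {c x y h : ℤ} (hx : 0 ≤ c * x + h) (hx' : c * x + h < c)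
    (hy : 0 ≤ c * y + h) (hy' : c * y + h < c) : x = y := by
  have hc : 0 < c := by linarith
  have h1 : x < y + 1 := lt_of_mul_lt_mul_left (by linarith : c * x < c * (y + 1)) hc.le
  have h2 : y < x + 1 := lt_of_mul_lt_mul_left (by linarith : c * y < c * (x + 1)) hc.le
  omega

/-- At fixed height, `c_j x_j` lies in a half-open interval of length `c_j`, which determines `x_j`;
the degree is then `t + ∑ x_j`. -/
theorem IsBoxPoint.eq_of_height_eq {d : ℕ} (hd : 0 < d) {p q : (Fin d → ℤ) × ℕ}
    (hp : p ∈ coneMonoid (vertexQ d)) (hq : q ∈ coneMonoid (vertexQ d))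
    (hpb : IsBoxPoint p) (hqb : IsBoxPoint q) (h : height p = height q) : p = q := by
  have h1 : p.1 = q.1 := by
    funext j
    have hp' := ((mem_coneMonoid_iff hd p).1 hp).2 j
    have hp'' := hpb.2 j
    rw [h] at hp' hp''
    exact int_eq_of_mul_add_bounds hp' hp'' (((mem_coneMonoid_iff hd q).1 hq).2 j) (hqb.2 j)
  refine Prod.ext h1 ?_
  simp only [height, h1] at h
  omega

theorem IsBoxPoint.exists_eq_boxPoint {d : ℕ} (hd : 0 < d) {p : (Fin d → ℤ) × ℕ}
    (hp : p ∈ coneMonoid (vertexQ d)) (hpb : IsBoxPoint p) :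
    ∃ k b, k ≤ d ∧ b < d ∧ p = boxPoint d k b := by
  obtain ⟨t, ht⟩ := Int.eq_ofNat_of_zero_le ((mem_coneMonoid_iff hd p).1 hp).1
  have hlt := hpb.1
  rw [ht] at hlt
  have hk : t / d ≤ d := Nat.lt_succ_iff.1 (Nat.div_lt_of_lt_mul (by exact_mod_cast hlt))
  have hb : t % d < d := Nat.mod_lt _ hd
  refine ⟨t / d, t % d, hk, hb, hpb.eq_of_height_eq hd hp (boxPoint_mem hk hb)
    (isBoxPoint_boxPoint hk hb) ?_⟩
  rw [ht, height_boxPoint hd]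
  exact_mod_cast (Nat.div_add_mod t d).symm

theorem boxPoint_injective {d k b k' b' : ℕ} (hb : b < d) (hb' : b' < d)
    (h : boxPoint d k b = boxPoint d k' b') : k = k' ∧ b = b' := by
  have hd : 0 < d := by omega
  have ht := congrArg height h
  rw [height_boxPoint hd, height_boxPoint hd] at ht
  have ht' : d * k + b = d * k' + b' := by exact_mod_cast ht
  have h1 := congrArg (· / d) ht'
  have h2 := congrArg (· % d) ht'
  simp only [Nat.mul_add_div hd, Nat.div_eq_of_lt hb, Nat.div_eq_of_lt hb', Nat.mul_add_mod,
    Nat.mod_eq_of_lt hb, Nat.mod_eq_of_lt hb'] at h1 h2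
  omega

/-! ### Integral closedness -/

/-- Shifting both parameters preserves the test `b < k`, so the correction terms agree. -/
theorem boxPoint_add_one_one (d k b : ℕ) :
    boxPoint d (k + 1) (b + 1) = boxPoint d k b + boxPoint d 1 1 := by
  ext j
  · simp only [boxPoint, Prod.fst_add, Pi.add_apply]
    split_ifs <;> omega
  · simp only [boxPoint, boxDegree, Prod.snd_add]
    split_ifs <;> omega

theorem boxPoint_zero_add_one (d b : ℕ) :
    boxPoint d 0 (b + 1) = boxPoint d 0 b + boxPoint d 0 1 := by
  ext j
  · simp [boxPoint]
  · simp [boxPoint, boxDegree]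

theorem exists_degree_one_summand {d : ℕ} (hd : 2 ≤ d) {p : (Fin d → ℤ) × ℕ}
    (hp : p ∈ coneMonoid (vertexQ d)) (hdeg : p.2 ≠ 0) :
    ∃ q ∈ coneMonoid (vertexQ d), ∃ r ∈ coneMonoid (vertexQ d), r.2 = 1 ∧ p = q + r := by
  have hd0 : 0 < d := by omega
  by_cases hbox : IsBoxPoint p
  · obtain ⟨k, b, hk, hb, rfl⟩ := hbox.exists_eq_boxPoint hd0 hp
    match b, k with
    -- For `b = 0` the degree is at most one, so the point itself is the summand.
    | 0, k =>
      refine ⟨_, zero_mem _, _, hp, ?_, (zero_add _).symm⟩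
      simp only [boxPoint, boxDegree] at hdeg ⊢
      split_ifs at hdeg ⊢ <;> omega
    | b + 1, 0 =>
      exact ⟨boxPoint d 0 b, boxPoint_mem hk (by omega), boxPoint d 0 1, boxPoint_mem hk hd, rfl,
        boxPoint_zero_add_one d b⟩
    | b + 1, k + 1 =>
      exact ⟨boxPoint d k b, boxPoint_mem (by omega) (by omega), boxPoint d 1 1,
        boxPoint_mem hd0 hd, rfl,
        boxPoint_add_one_one d k b⟩
  · obtain ⟨i, q, hq, rfl⟩ := exists_eq_add_vertexQ hd0 hp hbox
    exact ⟨q, hq, _, (vertexExponent (vertexQ d) i).2, rfl, rfl⟩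

theorem isIntegrallyClosed_simplex_vertexQ {d : ℕ} (hd : 2 ≤ d) :
    IsIntegrallyClosed (simplex (vertexQ d)) := by
  refine ⟨isLatticePolytope_simplex _, fun m => ?_⟩
  induction m with
  | zero =>
    intro x hx
    refine ⟨Fin.elim0, fun j => j.elim0, ?_⟩
    have hne : (simplex (vertexQ d)).Nonempty :=
      ⟨_, subset_convexHull ℝ _ (Set.mem_range_self 0)⟩
    rw [Nat.cast_zero, Set.zero_smul_set hne] at hx
    funext j
    simpa [toReal] using congrFun hx j
  | succ m ih =>
    intro x hx
    obtain ⟨q, hq, r, hr, hr1, hqr⟩ :=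
      exists_degree_one_summand hd (p := (x, m + 1)) hx (Nat.succ_ne_zero m)
    have hqm : q.2 = m := by
      have := congrArg Prod.snd hqr
      simp only [Prod.snd_add] at this
      omega
    obtain ⟨y, hy, hsum⟩ := ih q.1 (hqm ▸ hq)
    refine ⟨Fin.cons r.1 y, fun j => ?_, ?_⟩
    · refine Fin.cases ?_ (fun j => ?_) j
      · have hr' : toReal r.1 ∈ (r.2 : ℝ) • simplex (vertexQ d) := hr
        rw [hr1, Nat.cast_one, one_smul] at hr'
        simpa using hr'
      · simpa using hy j
    · rw [Fin.sum_univ_succ]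
      simp only [Fin.cons_zero, Fin.cons_succ]
      rw [← hsum, add_comm]
      exact congrArg Prod.fst hqr


/-! ### Monomial bases of the quotient ring -/

section Quotient

variable {n : ℕ} (v : Fin (n + 1) → (Fin n → ℤ))

/-- The class of the monomial `xᵃ zᵐ`, `s = (a, m)`, in `R_P`. -/
noncomputable def quotientMonomial (s : coneMonoid v) : R v :=
  Ideal.Quotient.mk (vertexIdeal v) (monomial v s)

/-- An exponent is reduced if its monomial is not divisible by any vertex monomial. -/
def IsReduced (s : coneMonoid v) : Prop :=
  ∀ i t, s ≠ t + vertexExponent v i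

/-- The ideal is generated by monomials, so membership is tested on each exponent of the support. -/
theorem mem_vertexIdeal_iff (f : SemigroupAlgebra v) :
    f ∈ vertexIdeal v ↔ ∀ s ∈ f.coeff.support, ¬ IsReduced v s := by
  have h : (Set.range fun i => monomial v (vertexExponent v i)) =
      AddMonoidAlgebra.of' ℂ (coneMonoid v) '' Set.range (vertexExponent v) := by
    rw [← Set.range_comp]
    rfl
  rw [vertexIdeal, h, AddMonoidAlgebra.mem_ideal_span_of'_image]
  simp [IsReduced]

theorem quotientMonomial_add (s t : coneMonoid v) :
    quotientMonomial v (s + t) = quotientMonomial v s * quotientMonomial v t := by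
  simp [quotientMonomial, monomial, ← map_mul, AddMonoidAlgebra.single_mul_single]

theorem quotientMonomial_eq_zero {s : coneMonoid v} (hs : ¬ IsReduced v s) :
    quotientMonomial v s = 0 := by
  rw [quotientMonomial, Ideal.Quotient.eq_zero_iff_mem, mem_vertexIdeal_iff]
  intro t ht
  have : t = s := by simpa [monomial] using ht
  rwa [this]

theorem linearIndependent_quotientMonomial :
    LinearIndependent ℂ (fun s : {s : coneMonoid v // IsReduced v s} => quotientMonomial v s) := by
  classical
  rw [linearIndependent_iff']
  intro S g hg s hs
  have hmem : ∑ t ∈ S, g t • monomial v t ∈ vertexIdeal v := by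
    rw [← Ideal.Quotient.eq_zero_iff_mem, ← hg, map_sum]
    rfl
  by_contra hne
  refine (mem_vertexIdeal_iff v _).1 hmem s.1 ?_ s.2
  have : (∑ t ∈ S, g t • monomial v t).coeff s.1 = g s := by
    rw [AddMonoidAlgebra.coeff_sum, Finsupp.finsetSum_apply, Finset.sum_eq_single s]
    · simp [monomial]
    · intro t _ hts
      have : t.1 ≠ s.1 := fun h => hts (Subtype.ext h)
      simp [monomial, this]
    · exact fun h => absurd hs h
  rw [Finsupp.mem_support_iff, this]
  exact hne

theorem gradedPiece_eq_span_reduced (k : ℕ) :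
    gradedPiece v k =
      Submodule.span ℂ (quotientMonomial v '' {s | IsReduced v s ∧ s.1.2 = k}) := by
  apply le_antisymm
  · refine Submodule.span_le.2 ?_
    rintro _ ⟨s, hs, rfl⟩
    by_cases hr : IsReduced v s
    · exact Submodule.subset_span ⟨s, ⟨hr, hs⟩, rfl⟩
    · change quotientMonomial v s ∈ _
      rw [quotientMonomial_eq_zero v hr]
      exact zero_mem _
  · refine Submodule.span_mono ?_
    rintro _ ⟨s, ⟨_, hs⟩, rfl⟩
    exact ⟨s, hs, rfl⟩

theorem span_reduced_eq_top :
    Submodule.span ℂ (quotientMonomial v '' {s | IsReduced v s}) = ⊤ := by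
  rw [eq_top_iff]
  rintro f -
  obtain ⟨f, rfl⟩ := Ideal.Quotient.mk_surjective f
  induction f using AddMonoidAlgebra.induction_on with
  | of s =>
    change quotientMonomial v s ∈ _
    by_cases hr : IsReduced v s
    · exact Submodule.subset_span ⟨s, hr, rfl⟩
    · rw [quotientMonomial_eq_zero v hr]
      exact zero_mem _
  | add f g hf hg =>
    rw [map_add]
    exact add_mem hf hg
  | smul r f hf => exact Submodule.smul_mem _ r hf

end Quotient

/-! ### The box monomials as a basis for `Δ_Q` -/

theorem isReduced_iff_isBoxPoint {d : ℕ} (hd : 0 < d) (s : coneMonoid (vertexQ d)) :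
    IsReduced (vertexQ d) s ↔ IsBoxPoint s.1 := by
  constructor
  · intro hs
    by_contra hbox
    obtain ⟨i, q, hq, h⟩ := exists_eq_add_vertexQ hd s.2 hbox
    exact hs i ⟨q, hq⟩ (Subtype.ext h)
  · rintro hs i t rfl
    exact not_isBoxPoint_add_vertexQ hd t.2 i hs

/-- The reduced exponents of the cone over `Δ_Q`. -/
def boxExponent (d : ℕ) (p : Fin (d + 1) × Fin d) : coneMonoid (vertexQ d) :=
  ⟨boxPoint d p.1 p.2, boxPoint_mem (Nat.lt_succ_iff.1 p.1.2) p.2.2⟩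

theorem isReduced_boxExponent {d : ℕ} (p : Fin (d + 1) × Fin d) :
    IsReduced (vertexQ d) (boxExponent d p) :=
  (isReduced_iff_isBoxPoint p.2.pos _).2
    (isBoxPoint_boxPoint (Nat.lt_succ_iff.1 p.1.2) p.2.2)

theorem IsReduced.exists_eq_boxExponent {d : ℕ} (hd : 0 < d) {s : coneMonoid (vertexQ d)}
    (hs : IsReduced (vertexQ d) s) : ∃ p, s = boxExponent d p := by
  obtain ⟨k, b, hk, hb, h⟩ :=
    ((isReduced_iff_isBoxPoint hd s).1 hs).exists_eq_boxPoint hd s.2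
  exact ⟨(⟨k, Nat.lt_succ_iff.2 hk⟩, ⟨b, hb⟩), Subtype.ext h⟩

theorem boxExponent_injective (d : ℕ) : Function.Injective (boxExponent d) := by
  rintro ⟨k, b⟩ ⟨k', b'⟩ h
  obtain ⟨h1, h2⟩ := boxPoint_injective b.2 b'.2 (congrArg Subtype.val h)
  exact Prod.ext (Fin.ext h1) (Fin.ext h2)

/-- The monomial basis of `R_P` for `P = Δ_Q`. -/
noncomputable def boxMonomial (d : ℕ) (p : Fin (d + 1) × Fin d) : R (vertexQ d) :=
  quotientMonomial (vertexQ d) (boxExponent d p)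

theorem linearIndependent_boxMonomial (d : ℕ) : LinearIndependent ℂ (boxMonomial d) :=
  (linearIndependent_quotientMonomial (vertexQ d)).comp
    (fun p => ⟨boxExponent d p, isReduced_boxExponent p⟩)
    fun _ _ h => boxExponent_injective d (congrArg Subtype.val h)

theorem finite_R_vertexQ {d : ℕ} (hd : 0 < d) : Module.Finite ℂ (R (vertexQ d)) := by
  refine ⟨Submodule.fg_def.2 ⟨Set.range (boxMonomial d), Set.finite_range _, ?_⟩⟩
  rw [eq_top_iff, ← span_reduced_eq_top]
  refine Submodule.span_mono ?_
  rintro _ ⟨s, hs, rfl⟩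
  obtain ⟨p, rfl⟩ := IsReduced.exists_eq_boxExponent hd hs
  exact ⟨p, rfl⟩

theorem gradedPiece_eq_span_boxMonomial {d : ℕ} (hd : 0 < d) (k : ℕ) :
    gradedPiece (vertexQ d) k =
      Submodule.span ℂ (Set.range fun p : {p : Fin (d + 1) × Fin d // boxDegree p.1 p.2 = k} =>
        boxMonomial d p) := by
  rw [gradedPiece_eq_span_reduced]
  congr 1
  ext f
  constructor
  · rintro ⟨s, ⟨hs, hk⟩, rfl⟩
    obtain ⟨p, rfl⟩ := IsReduced.exists_eq_boxExponent hd hs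
    exact ⟨⟨p, hk⟩, rfl⟩
  · rintro ⟨⟨p, hp⟩, rfl⟩
    exact ⟨boxExponent d p, ⟨isReduced_boxExponent p, hp⟩, rfl⟩

/-! ### Failure of the weak Lefschetz property -/

theorem finrank_gradedPiece {d : ℕ} (hd : 0 < d) (k : ℕ) :
    Module.finrank ℂ (gradedPiece (vertexQ d) k) =
      Fintype.card {p : Fin (d + 1) × Fin d // boxDegree p.1 p.2 = k} := by
  rw [gradedPiece_eq_span_boxMonomial hd, finrank_span_eq_card]
  exact (linearIndependent_boxMonomial d).comp _ Subtype.val_injective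

/-- Degree one consists of `(k,0)` with `1 ≤ k` and `(0,1)`, `(1,1)`; degree two of `(k,1)` with `2
≤ k` and `(0,2)`, `(1,2)`, `(2,2)`. The value `b = 2` needs `3 ≤ d`. -/
theorem finrank_gradedPiece_one_le_two {d : ℕ} (hd : 3 ≤ d) :
    Module.finrank ℂ (gradedPiece (vertexQ d) 1) ≤
      Module.finrank ℂ (gradedPiece (vertexQ d) 2) := by
  rw [finrank_gradedPiece (by omega), finrank_gradedPiece (by omega)]
  -- Sends `(k,1)` to `(k,2)`, the exceptional `(1,0)` to `(2,2)`, and `(k,0)` with `2 ≤ k` to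
  -- `(k,1)`.
  let φ : Fin (d + 1) × Fin d → Fin (d + 1) × Fin d := fun p =>
    if (p.2 : ℕ) = 1 then (p.1, ⟨2, by omega⟩)
    else if (p.1 : ℕ) = 1 then (⟨2, by omega⟩, ⟨2, by omega⟩) else (p.1, ⟨1, by omega⟩)
  refine Fintype.card_le_of_injective
    (fun p => (⟨φ p.1, ?_⟩ : {p : Fin (d + 1) × Fin d // boxDegree p.1 p.2 = 2})) ?_
  · obtain ⟨⟨k, b⟩, hp⟩ := p
    simp only [boxDegree, φ] at hp ⊢
    split_ifs at hp ⊢ <;> simp only [] at * <;> omega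
  · rintro ⟨⟨⟨k, _⟩, ⟨b, _⟩⟩, hp⟩ ⟨⟨⟨k', _⟩, ⟨b', _⟩⟩, hp'⟩ h
    suffices k = k' ∧ b = b' by
      obtain ⟨rfl, rfl⟩ := this
      rfl
    have h' := congrArg Subtype.val h
    simp only [boxDegree, φ] at hp hp' h'
    split_ifs at hp hp' h' <;> simp only [Prod.mk.injEq, Fin.mk.injEq] at h' <;> omega

/-- A product of a degree one monomial with a degree one box monomial of height divisible by `d`
is either zero or a box monomial of height congruent to one modulo `d`. -/
theorem quotientMonomial_mul_boxMonomial_mem {d : ℕ} (hd : 3 ≤ d) {s : coneMonoid (vertexQ d)}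
    (hs : s.1.2 = 1) (i : Fin d) :
    quotientMonomial (vertexQ d) s * boxMonomial d (i.succ, ⟨0, by omega⟩) ∈
      Submodule.span ℂ (Set.range fun j : Fin (d - 1) =>
        boxMonomial d (⟨j + 2, by omega⟩, ⟨1, by omega⟩)) := by
  have hd0 : 0 < d := by omega
  rw [boxMonomial, ← quotientMonomial_add]
  by_cases hr : IsReduced (vertexQ d) (s + boxExponent d (i.succ, ⟨0, by omega⟩))
  swap
  · rw [quotientMonomial_eq_zero _ hr]
    exact zero_mem _
  -- A summand of a reduced exponent is reduced, so `s` is a box point too.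
  have hsr : IsReduced (vertexQ d) s := by
    intro a t hst
    refine hr a (t + boxExponent d (i.succ, ⟨0, by omega⟩)) ?_
    rw [hst]
    abel
  obtain ⟨p, hp⟩ := IsReduced.exists_eq_boxExponent hd0 hr
  obtain ⟨q, rfl⟩ := IsReduced.exists_eq_boxExponent hd0 hsr
  have hdeg := congrArg (fun s : coneMonoid (vertexQ d) => s.1.2) hp
  have hheight := congrArg (fun s : coneMonoid (vertexQ d) => height s.1) hp
  simp only [boxExponent, AddSubmonoid.coe_add, height_add, height_boxPoint hd0] at hheight
  have hheight' : d * (q.1 : ℕ) + q.2 + d * (i + 1) = d * (p.1 : ℕ) + p.2 := by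
    simpa using (by exact_mod_cast hheight :
      d * (q.1 : ℕ) + q.2 + (d * (i.succ : ℕ) + 0) = d * (p.1 : ℕ) + p.2)
  have hmod : (q.2 : ℕ) = p.2 := by
    have := congrArg (· % d) hheight'
    simpa [Nat.add_mod, Nat.mod_eq_of_lt q.2.2, Nat.mod_eq_of_lt p.2.2] using this
  simp only [boxExponent, boxPoint, AddSubmonoid.coe_add, Prod.snd_add, boxDegree,
    Fin.val_succ] at hdeg hs
  -- Degree one gives `q.2 ≤ 1` and degree two gives `1 ≤ p.2`. As these remainders agree, both are
  -- `1`, and degree two then requires `1 < p.1`.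
  have hp2 : (p.2 : ℕ) = 1 ∧ 2 ≤ (p.1 : ℕ) := by
    split_ifs at hdeg hs <;> omega
  rw [hp]
  refine Submodule.subset_span ⟨⟨p.1 - 2, by omega⟩, ?_⟩
  simp only [boxMonomial]
  congr 2
  ext1 <;> apply Fin.ext <;> simp only [] <;> omega

theorem mul_boxMonomial_mem {d : ℕ} (hd : 3 ≤ d) {l : R (vertexQ d)}
    (hl : l ∈ gradedPiece (vertexQ d) 1) (i : Fin d) :
    l * boxMonomial d (i.succ, ⟨0, by omega⟩) ∈
      Submodule.span ℂ (Set.range fun j : Fin (d - 1) =>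
        boxMonomial d (⟨j + 2, by omega⟩, ⟨1, by omega⟩)) := by
  induction hl using Submodule.span_induction with
  | mem l hl =>
    obtain ⟨s, hs, rfl⟩ := hl
    exact quotientMonomial_mul_boxMonomial_mem hd hs i
  | zero =>
    rw [zero_mul]
    exact zero_mem _
  | add f g _ _ hf hg =>
    rw [add_mul]
    exact add_mem hf hg
  | smul r f _ hf =>
    rw [smul_mul_assoc]
    exact Submodule.smul_mem _ r hf

/-- Pigeonhole on dimensions: an injective map would keep the `d` monomials with `b = 0` independent
inside a span of `d - 1` vectors. -/
theorem not_injective_mulMap {d : ℕ} (hd : 3 ≤ d) (l : gradedPiece (vertexQ d) 1) :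
    ¬ Function.Injective (mulMap (vertexQ d) l 1) := by
  intro hinj
  have hd0 : 0 < d := by omega
  have hfin := finite_R_vertexQ hd0
  let y : Fin d → gradedPiece (vertexQ d) 1 := fun i =>
    ⟨boxMonomial d (i.succ, ⟨0, hd0⟩), by
      rw [gradedPiece_eq_span_boxMonomial hd0]
      exact Submodule.subset_span ⟨⟨_, by simp [boxDegree]⟩, rfl⟩⟩
  have hy : LinearIndependent ℂ y := by
    refine LinearIndependent.of_comp (gradedPiece (vertexQ d) 1).subtype ?_
    exact (linearIndependent_boxMonomial d).comp (fun i : Fin d => (i.succ, ⟨0, hd0⟩))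
      fun i j h => Fin.succ_injective _ (congrArg Prod.fst h)
  have hly : LinearIndependent ℂ fun i => (l : R (vertexQ d)) * y i :=
    (hy.map' _ (LinearMap.ker_eq_bot.2 hinj)).map' (gradedPiece (vertexQ d) 2).subtype
      (Submodule.ker_subtype _)
  have hle : Submodule.span ℂ (Set.range fun i => (l : R (vertexQ d)) * y i) ≤
      Submodule.span ℂ (Set.range fun j : Fin (d - 1) =>
        boxMonomial d (⟨j + 2, by omega⟩, ⟨1, by omega⟩)) := by
    refine Submodule.span_le.2 ?_
    rintro _ ⟨i, rfl⟩
    exact mul_boxMonomial_mem hd l.2 i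
  have h1 := Submodule.finrank_mono hle
  rw [finrank_span_eq_card hly] at h1
  have h2 := h1.trans (finrank_range_le_card _)
  simp only [Fintype.card_fin] at h2
  omega

theorem not_surjective_mulMap {d : ℕ} (hd : 3 ≤ d) (l : gradedPiece (vertexQ d) 1) :
    ¬ Function.Surjective (mulMap (vertexQ d) l 1) := by
  intro hsurj
  have hfin := finite_R_vertexQ (d := d) (by omega)
  have heq := le_antisymm (finrank_gradedPiece_one_le_two hd)
    (LinearMap.finrank_le_finrank_of_surjective hsurj)
  exact not_injective_mulMap hd l
    ((LinearMap.injective_iff_surjective_of_finrank_eq_finrank heq).2 hsurj)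

end LatticeSimplex

theorem proposition4p2 (d : ℕ) (hd : 3 ≤ d) :
    AffineIndependent ℝ (fun i => LatticeSimplex.toReal (LatticeSimplex.vertexQ d i)) ∧
    LatticeSimplex.HasType (LatticeSimplex.vertexQ d) (LatticeSimplex.weightQ d) 1 ∧
    LatticeSimplex.IsIntegrallyClosed (LatticeSimplex.simplex (LatticeSimplex.vertexQ d)) ∧
    LatticeSimplex.IsReflexive (LatticeSimplex.simplex (LatticeSimplex.vertexQ d)) ∧
    IsArtinianRing (LatticeSimplex.R (LatticeSimplex.vertexQ d)) ∧
    (∀ l : LatticeSimplex.gradedPiece (LatticeSimplex.vertexQ d) 1,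
      ¬ Function.Injective (LatticeSimplex.mulMap (LatticeSimplex.vertexQ d) l 1)) ∧
    ¬ ∃ l : LatticeSimplex.gradedPiece (LatticeSimplex.vertexQ d) 1,
      LatticeSimplex.IsWeakLefschetz (LatticeSimplex.vertexQ d) l := by
  open LatticeSimplex in
  have hd0 : 0 < d := by omega
  have := finite_R_vertexQ hd0
  exact ⟨affineIndependent_vertexQ hd0, hasType_vertexQ d,
    isIntegrallyClosed_simplex_vertexQ (by omega), isReflexive_simplex_vertexQ hd0,
    IsArtinianRing.of_finite ℂ _, not_injective_mulMap hd,
    fun ⟨l, hl⟩ => (hl 1).elim (not_injective_mulMap hd l) (not_surjective_mulMap hd l)⟩
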